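/- For complex numbers $x,p$ with $|p|<1$ let $(x;p)_\infty=\prod_{i=0}^{\infty}(1-xp^i)$. For every complex number $q$ with $|q|<1$, the series on the left below converges absolutely and $$\sum_{k=0}^{\infty}(-1)^k\frac{q^{2k}(1+q^{2k+1})}{(1-q^{2k+1})^3}=\frac{(q^2;q^4)_\infty^2\,(q^4;q^4)_\infty^6}{(q;q^2)_\infty^4}$$ (with the convention $0^0=1$ when $q=0$). -/

import Mathlib

/-- The infinite `q`-shifted factorial `(x; q)_∞ = ∏_{i ≥ 0} (1 - x q^i)`, used for `‖q‖ < 1`. -/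
noncomputable def qShiftedFactorialInf (x q : ℂ) : ℂ :=
  ∏' i : ℕ, (1 - x * q ^ i)

/-- For `‖q‖ < 1` the product defining `(x; q)_∞` converges, so `∏'` is its genuine value. -/
theorem qShiftedFactorialInf_hasProd (x q : ℂ) (hq : ‖q‖ < 1) :
    HasProd (fun i : ℕ => 1 - x * q ^ i) (qShiftedFactorialInf x q) := by
  have h : Multipliable (fun i : ℕ => 1 + -(x * q ^ i)) := by
    apply multipliable_one_add_of_summable
    simpa using (summable_geometric_of_lt_one (norm_nonneg q) hq).mul_left ‖x‖
  simpa [qShiftedFactorialInf, sub_eq_add_neg] using h.hasProd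

/-- If `‖q‖ < 1` and `‖x‖ < 1`, then `(x; q)_∞` is nonzero. -/
theorem qShiftedFactorialInf_ne_zero (x q : ℂ) (hq : ‖q‖ < 1) (hx : ‖x‖ < 1) :
    qShiftedFactorialInf x q ≠ 0 := by
  have h := tprod_one_add_ne_zero_of_summable (f := fun i : ℕ => -(x * q ^ i)) ?_ ?_
  · simpa [qShiftedFactorialInf, sub_eq_add_neg] using h
  · intro i hi
    have h1 : x * q ^ i = 1 := by linear_combination -hi
    have h2 : ‖x * q ^ i‖ < 1 := by
      rw [norm_mul, norm_pow]
      calc ‖x‖ * ‖q‖ ^ i ≤ ‖x‖ * 1 := by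
            gcongr
            exact pow_le_one₀ (norm_nonneg q) hq.le
        _ < 1 := by simpa using hx
    rw [h1] at h2
    simp at h2
  · simpa using (summable_geometric_of_lt_one (norm_nonneg q) hq).mul_left ‖x‖

/-!
The proof interpolates a polynomial in the variable `w = z + 1 / z` and lets its degree tend to
infinity. Put `x_k = q ^ (2k+1)` and `w_k = x_k + 1 / x_k` for `k ≤ 2M`. These `2M + 1` nodes are
distinct when `0 < ‖q‖ < 1`, so the polynomial
`f(w) = ∏_{1 ≤ j ≤ M} (1 + q^{8j} - q^{4j} w)²`, of degree at most `2M`, is given by its Lagrange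
interpolant. Both `f` and the interpolation weights factor over `z`, because
`1 + a² - a w = (1 - a z) (1 - a / z)`. At `w = 2`, that is `z = 1`, the interpolation formula
divided by `∏_{k ≤ 2M} (1 - x_k)²` reads
`(q⁴; q⁴)_M ^ 4 / (q; q²)_{2M+1} ^ 2 = ∑_{k ≤ 2M} t_k r_{M,k}`,
where `t_k` is the `k`-th term of the series and `r_{M,k}` is a quotient of finite `q`-shifted
factorials (`finite_identity`). The powers of `q` that come from the factors with negative exponents
combine to `(-1)^k q^{2k}`, and the cube arises as follows: two factors `1 - x_k` of the denominator
come from `f(w_k)`, two from `2 - w_k`, and the factor `1 - x_k²` in the numerator cancels one.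

As `M → ∞`, `r_{M,k}` stays bounded and tends to `(q; q²)_∞² / (q²; q²)_∞²`, so dominated
convergence for series gives
`(q⁴; q⁴)_∞⁴ / (q; q²)_∞² = (q; q²)_∞² / (q²; q²)_∞² * ∑ t_k`.
Since `(q²; q²)_∞ = (q²; q⁴)_∞ (q⁴; q⁴)_∞`, this is the claim.
-/

open Filter Topology

/-! ### Lagrange interpolation -/

open Finset in
theorem Lagrange.eval_eq_sum_prod {F ι : Type*} [Field F] [DecidableEq ι] {s : Finset ι} {v : ι → F}
    {f : Polynomial F} (hv : Set.InjOn v s) (hf : f.degree < #s) (z : F) :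
    f.eval z = ∑ i ∈ s, f.eval (v i) * ∏ j ∈ s.erase i, (z - v j) / (v i - v j) := by
  conv_lhs => rw [Lagrange.eq_interpolate hv hf]
  simp only [Lagrange.interpolate_apply, Polynomial.eval_finsetSum, Polynomial.eval_mul,
    Polynomial.eval_C, Lagrange.basis, Polynomial.eval_prod, Lagrange.basisDivisor,
    Polynomial.eval_sub, Polynomial.eval_X]
  refine sum_congr rfl fun i _ => ?_
  congr 1
  exact prod_congr rfl fun j _ => by rw [div_eq_inv_mul]

/-! ### Finite shifted factorials -/

/-- The finite `q`-shifted factorial `(x; p)_n = ∏_{i < n} (1 - x p^i)`. -/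
noncomputable def qShiftedFactorial (x p : ℂ) (n : ℕ) : ℂ :=
  ∏ i ∈ Finset.range n, (1 - x * p ^ i)

theorem qShiftedFactorial_add (x p : ℂ) (m n : ℕ) :
    qShiftedFactorial x p (m + n) =
      qShiftedFactorial x p m * qShiftedFactorial (x * p ^ m) p n := by
  simp only [qShiftedFactorial, Finset.prod_range_add, pow_add, mul_assoc]

theorem qShiftedFactorial_one (x p : ℂ) : qShiftedFactorial x p 1 = 1 - x := by
  simp [qShiftedFactorial]

theorem one_sub_mul_pow_ne_zero {x p : ℂ} (hx : ‖x‖ < 1) (hp : ‖p‖ < 1) (i : ℕ) :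
    1 - x * p ^ i ≠ 0 := by
  intro h
  have h1 : ‖x * p ^ i‖ < 1 := by
    rw [norm_mul, norm_pow]
    calc ‖x‖ * ‖p‖ ^ i ≤ ‖x‖ * 1 := by
          gcongr
          exact pow_le_one₀ (norm_nonneg p) hp.le
      _ < 1 := by simpa using hx
  rw [← sub_eq_zero.mp h] at h1
  simp at h1

theorem qShiftedFactorial_ne_zero {x p : ℂ} (hx : ‖x‖ < 1) (hp : ‖p‖ < 1) (n : ℕ) :
    qShiftedFactorial x p n ≠ 0 :=
  Finset.prod_ne_zero_iff.mpr fun i _ => one_sub_mul_pow_ne_zero hx hp i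

/-! ### Factorization of the interpolation data -/

/-- Reversing the product turns negative powers of `p` into positive ones. -/
theorem prod_one_sub_div_mul_pow {s p : ℂ} (hs : s ≠ 0) (hp : p ≠ 0) (m : ℕ) :
    ∏ j ∈ Finset.range m, (1 - p ^ (j + 1) / (s * p ^ m)) =
      (∏ j ∈ Finset.range m, (-1 / (s * p ^ j))) * qShiftedFactorial s p m := by
  rw [← Finset.prod_range_reflect, qShiftedFactorial, ← Finset.prod_mul_distrib]
  refine Finset.prod_congr rfl fun j hj => ?_
  obtain ⟨d, rfl⟩ := Nat.exists_eq_add_of_lt (Finset.mem_range.mp hj)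
  rw [show j + d + 1 - 1 - j + 1 = d + 1 by omega, show j + d + 1 = j + (d + 1) by omega,
    pow_add p j]
  field_simp
  ring

/-- For `x = s p^m`, the product of `(1 - p^{j+1} x) (1 - p^{j+1} / x)` runs through the factors of
`(s; p)_∞` and `(p / s; p)_∞`, up to the missing factor `1 - x` and the sign and powers of `s`, `p`
from the first `m` of the quotients `p^{j+1} / x`. -/
theorem prod_one_sub_mul_one_sub_div {s p : ℂ} (hs : s ≠ 0) (hp : p ≠ 0) (m d : ℕ) :
    (∏ j ∈ Finset.range (m + d),
        (1 - p ^ (j + 1) * (s * p ^ m)) * (1 - p ^ (j + 1) / (s * p ^ m))) * (1 - s * p ^ m) =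
      (∏ j ∈ Finset.range m, (-1 / (s * p ^ j))) *
        (qShiftedFactorial s p (2 * m + d + 1) * qShiftedFactorial (p / s) p d) := by
  rw [Finset.prod_mul_distrib, Finset.prod_range_add (fun j => 1 - p ^ (j + 1) / (s * p ^ m)),
    prod_one_sub_div_mul_pow hs hp,
    show 2 * m + d + 1 = m + 1 + (m + d) by omega, qShiftedFactorial_add,
    qShiftedFactorial_add s p m 1, qShiftedFactorial_one]
  have h1 : ∏ j ∈ Finset.range (m + d), (1 - p ^ (j + 1) * (s * p ^ m)) =
      qShiftedFactorial (s * p ^ (m + 1)) p (m + d) :=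
    Finset.prod_congr rfl fun j _ => by ring
  have h2 : ∏ j ∈ Finset.range d, (1 - p ^ (m + j + 1) / (s * p ^ m)) =
      qShiftedFactorial (p / s) p d :=
    Finset.prod_congr rfl fun j _ => by
      rw [show m + j + 1 = m + (j + 1) by omega, pow_add p m]
      field_simp
      ring
  rw [h1, h2]
  ring

theorem prod_erase_one_sub {p : ℂ} (hp : p ≠ 0) (k d : ℕ) :
    ∏ j ∈ (Finset.range (k + 1 + d)).erase k, (1 - p ^ j / p ^ k) =
      (∏ j ∈ Finset.range k, (-1 / (p * p ^ j))) *
        (qShiftedFactorial p p k * qShiftedFactorial p p d) := by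
  have hs : (Finset.range (k + 1 + d)).erase k =
      Finset.range k ∪ (Finset.range d).map (addLeftEmbedding (k + 1)) := by
    ext j
    simp only [Finset.mem_erase, Finset.mem_range, Finset.mem_union, Finset.mem_map,
      addLeftEmbedding_apply]
    constructor
    · rintro ⟨h1, h2⟩
      rcases lt_or_gt_of_ne h1 with h | h
      · exact Or.inl h
      · exact Or.inr ⟨j - (k + 1), by omega, by omega⟩
    · rintro (h | ⟨i, hi, rfl⟩) <;> constructor <;> omega
  have hd : Disjoint (Finset.range k) ((Finset.range d).map (addLeftEmbedding (k + 1))) := by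
    rw [Finset.disjoint_left]
    simp only [Finset.mem_range, Finset.mem_map, addLeftEmbedding_apply]
    rintro a ha ⟨i, hi, rfl⟩
    omega
  rw [hs, Finset.prod_union hd, Finset.prod_map, ← mul_assoc, ← prod_one_sub_div_mul_pow hp hp]
  congr 1
  · exact Finset.prod_congr rfl fun j _ => by field_simp; ring
  · refine Finset.prod_congr rfl fun j _ => ?_
    rw [addLeftEmbedding_apply, show k + 1 + j = k + (j + 1) by omega, pow_add]
    field_simp
    ring

/-- The sign and power of `q` split off at an even node `k = 2m`. Its square is `q^{k - k²}`,
which is stated without negative exponents; `prod_neg_one_div_odd` is the same for `k = 2m + 1`. -/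
theorem prod_neg_one_div_even {q : ℂ} (hq : q ≠ 0) (m : ℕ) :
    (∏ j ∈ Finset.range m, (-1 / (q * (q ^ 4) ^ j))) ^ 2 * q ^ ((2 * m) ^ 2) = q ^ (2 * m) := by
  induction m with
  | zero => simp
  | succ m ih =>
    rw [Finset.prod_range_succ, mul_pow,
      show (2 * (m + 1)) ^ 2 = (2 * m) ^ 2 + 8 * m + 4 by ring, pow_add, pow_add,
      show ∀ a b c d e : ℂ, a * b * (c * d * e) = (a * c) * (b * d * e) by intros; ring, ih,
      div_pow, mul_pow, ← pow_mul, ← pow_mul]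
    field_simp
    ring

theorem prod_neg_one_div_odd {q : ℂ} (hq : q ≠ 0) (m : ℕ) :
    (∏ j ∈ Finset.range m, (-1 / (q ^ 3 * (q ^ 4) ^ j))) ^ 2 * q ^ ((2 * m + 1) ^ 2) =
      q ^ (2 * m + 1) := by
  induction m with
  | zero => simp
  | succ m ih =>
    rw [Finset.prod_range_succ, mul_pow,
      show (2 * (m + 1) + 1) ^ 2 = (2 * m + 1) ^ 2 + 8 * m + 8 by ring, pow_add, pow_add,
      show ∀ a b c d e : ℂ, a * b * (c * d * e) = (a * c) * (b * d * e) by intros; ring, ih,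
      div_pow, mul_pow, ← pow_mul, ← pow_mul]
    field_simp
    ring

theorem prod_neg_one_div_sq {q : ℂ} (hq : q ≠ 0) (k : ℕ) :
    (∏ j ∈ Finset.range k, (-1 / (q ^ 2 * (q ^ 2) ^ j))) * q ^ (k ^ 2 + k) = (-1) ^ k := by
  induction k with
  | zero => simp
  | succ k ih =>
    rw [Finset.prod_range_succ,
      show (k + 1) ^ 2 + (k + 1) = (k ^ 2 + k) + (2 * k + 2) by ring, pow_add q (k ^ 2 + k),
      show ∀ a b c d : ℂ, a * b * (c * d) = (a * c) * (b * d) by intros; ring, ih, ← pow_mul]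
    field_simp
    ring

/-- At `x = q^{2k+1}`, the product `∏_{1 ≤ j ≤ M} (1 - q^{4j} x) (1 - q^{4j} / x)` is this
quantity divided by `1 - x`, up to a sign and a power of `q`. It tends to `(q; q²)_∞` as
`M → ∞`, for each `k`. -/
noncomputable def nodeFactor (q : ℂ) (M k : ℕ) : ℂ :=
  if Even k then
    qShiftedFactorial q (q ^ 4) (M + k / 2 + 1) * qShiftedFactorial (q ^ 3) (q ^ 4) (M - k / 2)
  else qShiftedFactorial (q ^ 3) (q ^ 4) (M + k / 2 + 1) * qShiftedFactorial q (q ^ 4) (M - k / 2)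

/-- The value of the interpolated polynomial at the `k`-th node. For even `k = 2m` the node is
`q (q⁴)^m`, for odd `k = 2m + 1` it is `q³ (q⁴)^m`. The condition `k ≤ 2M` ensures that all factors
with a negative exponent of `q` occur, so that no truncated subtraction takes place in
`nodeFactor`. -/
theorem prod_node_sq {q : ℂ} (hq : q ≠ 0) {M k : ℕ} (hk : k ≤ 2 * M) :
    (∏ j ∈ Finset.range M, (1 - (q ^ 4) ^ (j + 1) * q ^ (2 * k + 1)) *
        (1 - (q ^ 4) ^ (j + 1) / q ^ (2 * k + 1))) ^ 2 * (1 - q ^ (2 * k + 1)) ^ 2 * q ^ (k ^ 2) =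
      q ^ k * nodeFactor q M k ^ 2 := by
  rcases Nat.even_or_odd' k with ⟨m, rfl | rfl⟩
  · obtain ⟨d, rfl⟩ := Nat.exists_eq_add_of_le (show m ≤ M by omega)
    have h := prod_one_sub_mul_one_sub_div (s := q) (p := q ^ 4) hq (pow_ne_zero 4 hq) m d
    have e : q ^ (2 * (2 * m) + 1) = q * (q ^ 4) ^ m := by ring
    have e3 : q ^ 4 / q = q ^ 3 := by field_simp
    rw [e, ← mul_pow, h, e3, nodeFactor, if_pos (by simp), ← prod_neg_one_div_even hq,
      show m + d + 2 * m / 2 + 1 = 2 * m + d + 1 by omega, show m + d - 2 * m / 2 = d by omega]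
    ring
  · obtain ⟨d, rfl⟩ := Nat.exists_eq_add_of_le (show m ≤ M by omega)
    have h := prod_one_sub_mul_one_sub_div (s := q ^ 3) (p := q ^ 4) (pow_ne_zero 3 hq)
      (pow_ne_zero 4 hq) m d
    have e : q ^ (2 * (2 * m + 1) + 1) = q ^ 3 * (q ^ 4) ^ m := by ring
    have e3 : q ^ 4 / q ^ 3 = q := by field_simp
    rw [e, ← mul_pow, h, e3, nodeFactor, if_neg (by simp), ← prod_neg_one_div_odd hq,
      show m + d + (2 * m + 1) / 2 + 1 = 2 * m + d + 1 by omega,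
      show m + d - (2 * m + 1) / 2 = d by omega]
    ring

/-- The denominator of the interpolation weight at the `k`-th node. -/
theorem prod_erase_node {q : ℂ} (hq : q ≠ 0) {N k : ℕ} (hk : k < N) :
    (∏ j ∈ (Finset.range N).erase k, (1 - q ^ (2 * j + 1) * q ^ (2 * k + 1)) *
        (1 - q ^ (2 * j + 1) / q ^ (2 * k + 1))) * (1 - (q ^ (2 * k + 1)) ^ 2) * q ^ (k ^ 2 + k) =
      (-1) ^ k * (qShiftedFactorial (q ^ 2) (q ^ 2) (N - 1 - k) *
        qShiftedFactorial (q ^ 2) (q ^ 2) (N + k)) := by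
  obtain ⟨d, rfl⟩ := Nat.exists_eq_add_of_lt hk
  have h1 : (∏ j ∈ (Finset.range (k + d + 1)).erase k, (1 - q ^ (2 * j + 1) * q ^ (2 * k + 1))) *
      (1 - (q ^ (2 * k + 1)) ^ 2) =
      qShiftedFactorial (q ^ 2 * (q ^ 2) ^ k) (q ^ 2) (k + d + 1) := by
    rw [sq, Finset.prod_erase_mul _ (fun j => 1 - q ^ (2 * j + 1) * q ^ (2 * k + 1))
      (Finset.mem_range.mpr hk)]
    exact Finset.prod_congr rfl fun j _ => by ring
  have h2 := prod_erase_one_sub (pow_ne_zero 2 hq) k d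
  have h3 : ∏ j ∈ (Finset.range (k + d + 1)).erase k, (1 - q ^ (2 * j + 1) / q ^ (2 * k + 1)) =
      ∏ j ∈ (Finset.range (k + 1 + d)).erase k, (1 - (q ^ 2) ^ j / (q ^ 2) ^ k) := by
    rw [add_right_comm]
    refine Finset.prod_congr rfl fun j _ => ?_
    rw [pow_succ, pow_succ, mul_div_mul_right _ _ hq, pow_mul, pow_mul]
  rw [Finset.prod_mul_distrib, mul_right_comm _ _ (1 - _), h1, h3, h2, ← prod_neg_one_div_sq hq k,
    show k + d + 1 - 1 - k = d by omega, show k + d + 1 + k = k + (k + d + 1) by omega,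
    qShiftedFactorial_add _ _ k]
  ring

/-! ### The finite form of the identity -/

theorem norm_pow_lt_one {q : ℂ} (hq : ‖q‖ < 1) {n : ℕ} (hn : n ≠ 0) : ‖q ^ n‖ < 1 := by
  rw [norm_pow]
  exact pow_lt_one₀ (norm_nonneg q) hq hn

theorem one_sub_pow_ne_zero {q : ℂ} (hq : ‖q‖ < 1) {n : ℕ} (hn : n ≠ 0) : 1 - q ^ n ≠ 0 := by
  intro h
  have h1 := norm_pow_lt_one hq hn
  rw [← sub_eq_zero.mp h] at h1
  simp at h1

theorem one_sub_pow_div_pow_ne_zero {q : ℂ} (hq0 : q ≠ 0) (hq : ‖q‖ < 1) {m n : ℕ} (h : m ≠ n) :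
    1 - q ^ m / q ^ n ≠ 0 := by
  intro h0
  have h1 : q ^ m = q ^ n :=
    ((div_eq_one_iff_eq (pow_ne_zero n hq0)).mp (sub_eq_zero.mp h0).symm)
  have h2 : ‖q‖ ^ m = ‖q‖ ^ n := by rw [← norm_pow, ← norm_pow, h1]
  exact h (pow_right_injective₀ (norm_pos_iff.mpr hq0) hq.ne h2)

theorem node_sub_node {x y : ℂ} (hx : x ≠ 0) (hy : y ≠ 0) :
    -y * (x + 1 / x - (y + 1 / y)) = (1 - y * x) * (1 - y / x) := by
  field_simp
  ring

/-- Lagrange interpolation of `∏_{j < M} (1 + q^{8(j+1)} - q^{4(j+1)} w)²` at the nodes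
`w_k = q^{2k+1} + q^{-(2k+1)}`, `k ≤ 2M`, evaluated at `w = 2`. -/
theorem finite_identity {q : ℂ} (hq0 : q ≠ 0) (hq : ‖q‖ < 1) (M : ℕ) :
    ∑ k ∈ Finset.range (2 * M + 1),
      (-1 : ℂ) ^ k * (q ^ (2 * k) * (1 + q ^ (2 * k + 1)) / (1 - q ^ (2 * k + 1)) ^ 3) *
        (nodeFactor q M k ^ 2 / (qShiftedFactorial (q ^ 2) (q ^ 2) (2 * M - k) *
          qShiftedFactorial (q ^ 2) (q ^ 2) (2 * M + 1 + k))) =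
      qShiftedFactorial (q ^ 4) (q ^ 4) M ^ 4 / qShiftedFactorial q (q ^ 2) (2 * M + 1) ^ 2 := by
  set N := 2 * M + 1 with hN
  let v : ℕ → ℂ := fun k => q ^ (2 * k + 1) + 1 / q ^ (2 * k + 1)
  have hx (k : ℕ) : q ^ (2 * k + 1) ≠ 0 := pow_ne_zero _ hq0
  have hx1 (k : ℕ) : 1 - q ^ (2 * k + 1) ≠ 0 := one_sub_pow_ne_zero hq (by omega)
  have hfac (j k : ℕ) (hjk : j ≠ k) :
      (1 - q ^ (2 * j + 1) * q ^ (2 * k + 1)) * (1 - q ^ (2 * j + 1) / q ^ (2 * k + 1)) ≠ 0 := by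
    rw [← pow_add]
    exact mul_ne_zero (one_sub_pow_ne_zero hq (by omega))
      (one_sub_pow_div_pow_ne_zero hq0 hq (by omega))
  have hv : Set.InjOn v (Finset.range N) := by
    intro k _ j _ h
    by_contra hne
    refine hfac j k (Ne.symm hne) ?_
    rw [← node_sub_node (hx k) (hx j)]
    exact mul_eq_zero_of_right _ (sub_eq_zero.mpr h)
  let f : Polynomial ℂ := ∏ j ∈ Finset.range M,
    (Polynomial.C (-(q ^ 4) ^ (j + 1)) * Polynomial.X +
      Polynomial.C (1 + ((q ^ 4) ^ (j + 1)) ^ 2)) ^ 2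
  have hf : f.degree < (Finset.range N).card := by
    rw [Finset.card_range]
    calc f.degree ≤ ∑ j ∈ Finset.range M, (2 : WithBot ℕ) := by
          refine (Polynomial.degree_prod_le _ _).trans (Finset.sum_le_sum fun j _ => ?_)
          refine (Polynomial.degree_pow_le _ _).trans ?_
          refine (nsmul_le_nsmul_right Polynomial.degree_linear_le 2).trans ?_
          norm_num
      _ = ((2 * M : ℕ) : WithBot ℕ) := by
          rw [Finset.sum_const, Finset.card_range, mul_comm]
          simp
      _ < N := by exact_mod_cast Nat.lt_succ_self _
  -- On `w = x + 1 / x` each factor splits as `1 + a² - a w = (1 - a x) (1 - a / x)`.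
  have hfev (x : ℂ) (h : x ≠ 0) : f.eval (x + 1 / x) = (∏ j ∈ Finset.range M,
      (1 - (q ^ 4) ^ (j + 1) * x) * (1 - (q ^ 4) ^ (j + 1) / x)) ^ 2 := by
    simp only [f, Polynomial.eval_prod, ← Finset.prod_pow]
    refine Finset.prod_congr rfl fun j _ => ?_
    simp only [Polynomial.eval_pow, Polynomial.eval_add, Polynomial.eval_mul, Polynomial.eval_C,
      Polynomial.eval_X]
    congr 1
    field_simp
    ring
  -- The evaluation point `w = 2` is written `1 + 1 / 1`, so that the factorization applies.
  have hf2 : f.eval (1 + 1 / 1) = qShiftedFactorial (q ^ 4) (q ^ 4) M ^ 4 := by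
    rw [hfev 1 one_ne_zero, qShiftedFactorial, ← Finset.prod_pow, ← Finset.prod_pow]
    exact Finset.prod_congr rfl fun j _ => by ring
  rw [← hf2, Lagrange.eval_eq_sum_prod hv hf, Finset.sum_div]
  refine Finset.sum_congr rfl fun k hk => ?_
  have hkN : k < N := Finset.mem_range.mp hk
  have hB : qShiftedFactorial q (q ^ 2) N =
      (∏ j ∈ (Finset.range N).erase k, (1 - q ^ (2 * j + 1))) * (1 - q ^ (2 * k + 1)) := by
    rw [Finset.prod_erase_mul _ (fun j => 1 - q ^ (2 * j + 1)) hk]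
    exact Finset.prod_congr rfl fun j _ => by ring
  have hprod : ∏ j ∈ (Finset.range N).erase k, (1 + 1 / 1 - v j) / (v k - v j) =
      (∏ j ∈ (Finset.range N).erase k, (1 - q ^ (2 * j + 1))) ^ 2 /
        ∏ j ∈ (Finset.range N).erase k, (1 - q ^ (2 * j + 1) * q ^ (2 * k + 1)) *
          (1 - q ^ (2 * j + 1) / q ^ (2 * k + 1)) := by
    rw [← Finset.prod_pow, ← Finset.prod_div_distrib]
    refine Finset.prod_congr rfl fun j _ => ?_
    rw [← node_sub_node (hx k) (hx j), ← mul_div_mul_left _ _ (neg_ne_zero.mpr (hx j)),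
      node_sub_node one_ne_zero (hx j)]
    simp only [v, mul_one, div_one, sq]
  -- What remains is algebra in the factorizations of the numerator and the denominator.
  have hnum := prod_node_sq hq0 (show k ≤ 2 * M by omega)
  have hden := prod_erase_node hq0 hkN
  rw [show N - 1 - k = 2 * M - k by omega] at hden
  have hP : ∏ j ∈ (Finset.range N).erase k, (1 - q ^ (2 * j + 1)) ≠ 0 :=
    Finset.prod_ne_zero_iff.mpr fun j _ => hx1 j
  have hD : ∏ j ∈ (Finset.range N).erase k, (1 - q ^ (2 * j + 1) * q ^ (2 * k + 1)) *
      (1 - q ^ (2 * j + 1) / q ^ (2 * k + 1)) ≠ 0 :=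
    Finset.prod_ne_zero_iff.mpr fun j hj => hfac j k (Finset.ne_of_mem_erase hj)
  have hE (n : ℕ) : qShiftedFactorial (q ^ 2) (q ^ 2) n ≠ 0 :=
    qShiftedFactorial_ne_zero (norm_pow_lt_one hq two_ne_zero) (norm_pow_lt_one hq two_ne_zero) n
  rw [hB, hprod, hfev _ (hx k)]
  have hE1 := hE (2 * M - k)
  have hE2 := hE (N + k)
  have hxk := hx1 k
  have hsgn : ((-1 : ℂ) ^ k) * (-1) ^ k = 1 := by rw [← mul_pow]; simp
  generalize ∏ j ∈ (Finset.range N).erase k, (1 - q ^ (2 * j + 1) * q ^ (2 * k + 1)) *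
      (1 - q ^ (2 * j + 1) / q ^ (2 * k + 1)) = D at *
  generalize (∏ j ∈ Finset.range M, (1 - (q ^ 4) ^ (j + 1) * q ^ (2 * k + 1)) *
        (1 - (q ^ 4) ^ (j + 1) / q ^ (2 * k + 1))) ^ 2 = A at *
  generalize ∏ j ∈ (Finset.range N).erase k, (1 - q ^ (2 * j + 1)) = P at *
  generalize qShiftedFactorial (q ^ 2) (q ^ 2) (2 * M - k) = E1 at *
  generalize qShiftedFactorial (q ^ 2) (q ^ 2) (N + k) = E2 at *
  generalize nodeFactor q M k = R at *
  rw [pow_add q (k ^ 2)] at hden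
  rw [pow_mul' q 2 k]
  generalize q ^ (2 * k + 1) = x at *
  have hqk : q ^ k ≠ 0 := pow_ne_zero k hq0
  have hqk2 : q ^ (k ^ 2) ≠ 0 := pow_ne_zero _ hq0
  generalize q ^ k = y at *
  generalize q ^ (k ^ 2) = w at *
  generalize (-1 : ℂ) ^ k = s at *
  have key : s * y ^ 2 * (1 - x ^ 2) * R ^ 2 * D = A * (1 - x) ^ 2 * (E1 * E2) := by
    apply mul_right_cancel₀ hqk2
    linear_combination (s * y * R ^ 2) * hden - E1 * E2 * hnum + (y * R^2 * E1 * E2) * hsgn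
  field_simp
  apply mul_left_cancel₀ hxk
  linear_combination key

/-! ### The limit -/

theorem tendsto_qShiftedFactorial (x : ℂ) {p : ℂ} (hp : ‖p‖ < 1) :
    Tendsto (qShiftedFactorial x p) atTop (𝓝 (qShiftedFactorialInf x p)) :=
  (qShiftedFactorialInf_hasProd x p hp).tendsto_prod_nat

theorem qShiftedFactorialInf_eq_even_mul_odd (x : ℂ) {p : ℂ} (hp : ‖p‖ < 1) :
    qShiftedFactorialInf x p =
      qShiftedFactorialInf x (p ^ 2) * qShiftedFactorialInf (x * p) (p ^ 2) := by
  have hp2 := norm_pow_lt_one hp two_ne_zero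
  refine (qShiftedFactorialInf_hasProd x p hp).unique (HasProd.even_mul_odd ?_ ?_)
  · simpa only [pow_mul] using qShiftedFactorialInf_hasProd x (p ^ 2) hp2
  · simpa only [pow_succ', pow_mul, mul_assoc] using
      qShiftedFactorialInf_hasProd (x * p) (p ^ 2) hp2

theorem exists_norm_le_of_tendsto {u : ℕ → ℂ} {l : ℂ} (h : Tendsto u atTop (𝓝 l)) :
    ∃ C, ∀ n, ‖u n‖ ≤ C := by
  obtain ⟨C, hC⟩ := (Metric.isBounded_range_of_tendsto u h).exists_norm_le
  exact ⟨C, fun n => hC _ ⟨n, rfl⟩⟩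

theorem tendsto_nodeFactor {q : ℂ} (hq : ‖q‖ < 1) (k : ℕ) :
    Tendsto (fun M => nodeFactor q M k) atTop (𝓝 (qShiftedFactorialInf q (q ^ 2))) := by
  have h4 := norm_pow_lt_one hq four_ne_zero
  have hplus : Tendsto (fun M : ℕ => M + k / 2 + 1) atTop atTop :=
    tendsto_atTop_mono (fun M => by dsimp only [id]; omega) tendsto_id
  have hminus : Tendsto (fun M : ℕ => M - k / 2) atTop atTop := tendsto_sub_atTop_nat _
  have hsplit : qShiftedFactorialInf q (q ^ 2) =
      qShiftedFactorialInf q (q ^ 4) * qShiftedFactorialInf (q ^ 3) (q ^ 4) := by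
    rw [qShiftedFactorialInf_eq_even_mul_odd q (norm_pow_lt_one hq two_ne_zero), ← pow_mul,
      ← pow_succ']
  have ha := tendsto_qShiftedFactorial q h4
  have hb := tendsto_qShiftedFactorial (q ^ 3) h4
  rw [hsplit]
  by_cases hk : Even k
  · simp only [nodeFactor, if_pos hk]
    exact (ha.comp hplus).mul (hb.comp hminus)
  · simp only [nodeFactor, if_neg hk]
    rw [mul_comm]
    exact (hb.comp hplus).mul (ha.comp hminus)

theorem exists_norm_nodeFactor_le {q : ℂ} (hq : ‖q‖ < 1) :
    ∃ C, ∀ M k, ‖nodeFactor q M k‖ ≤ C := by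
  have h4 := norm_pow_lt_one hq four_ne_zero
  obtain ⟨A, hA⟩ := exists_norm_le_of_tendsto (tendsto_qShiftedFactorial q h4)
  obtain ⟨B, hB⟩ := exists_norm_le_of_tendsto (tendsto_qShiftedFactorial (q ^ 3) h4)
  have hA0 : 0 ≤ A := (norm_nonneg _).trans (hA 0)
  have hB0 : 0 ≤ B := (norm_nonneg _).trans (hB 0)
  refine ⟨A * B, fun M k => ?_⟩
  unfold nodeFactor
  split_ifs
  · rw [norm_mul]
    exact mul_le_mul (hA _) (hB _) (norm_nonneg _) hA0
  · rw [norm_mul, mul_comm A]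
    exact mul_le_mul (hB _) (hA _) (norm_nonneg _) hB0

theorem norm_term_le {q : ℂ} (hq : ‖q‖ < 1) (k : ℕ) :
    ‖(-1 : ℂ) ^ k * (q ^ (2 * k) * (1 + q ^ (2 * k + 1)) / (1 - q ^ (2 * k + 1)) ^ 3)‖ ≤
      2 / (1 - ‖q‖) ^ 3 * (‖q‖ ^ 2) ^ k := by
  have hx : ‖q ^ (2 * k + 1)‖ ≤ ‖q‖ := by
    rw [norm_pow]
    exact pow_le_of_le_one (norm_nonneg q) hq.le (by omega)
  have h1 : ‖1 + q ^ (2 * k + 1)‖ ≤ 2 := by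
    refine (norm_add_le _ _).trans ?_
    rw [norm_one]
    linarith
  have h2 : 1 - ‖q‖ ≤ ‖1 - q ^ (2 * k + 1)‖ := by
    have := norm_sub_norm_le (1 : ℂ) (q ^ (2 * k + 1))
    rw [norm_one] at this
    linarith
  have h0 : 0 < 1 - ‖q‖ := by linarith
  rw [norm_mul, norm_pow, norm_neg, norm_one, one_pow, one_mul, norm_div, norm_mul, norm_pow,
    norm_pow, pow_mul, mul_comm (2 / _), mul_div_assoc]
  gcongr

theorem summable_bound {q : ℂ} (hq : ‖q‖ < 1) (C : ℝ) :
    Summable fun k : ℕ => C * (‖q‖ ^ 2) ^ k :=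
  (summable_geometric_of_lt_one (by positivity)
    (pow_lt_one₀ (norm_nonneg q) hq two_ne_zero)).mul_left C

theorem hasSum_of_ne_zero {q : ℂ} (hq0 : q ≠ 0) (hq : ‖q‖ < 1) :
    HasSum
      (fun k : ℕ =>
        (-1 : ℂ) ^ k * (q ^ (2 * k) * (1 + q ^ (2 * k + 1)) / (1 - q ^ (2 * k + 1)) ^ 3))
      (qShiftedFactorialInf (q ^ 2) (q ^ 4) ^ 2 * qShiftedFactorialInf (q ^ 4) (q ^ 4) ^ 6 /
        qShiftedFactorialInf q (q ^ 2) ^ 4) := by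
  set t : ℕ → ℂ := fun k =>
    (-1 : ℂ) ^ k * (q ^ (2 * k) * (1 + q ^ (2 * k + 1)) / (1 - q ^ (2 * k + 1)) ^ 3)
  have h2 := norm_pow_lt_one hq two_ne_zero
  have h4 := norm_pow_lt_one hq four_ne_zero
  have hsum : Summable t := Summable.of_norm_bounded (summable_bound hq _) (norm_term_le hq)
  have hE := tendsto_qShiftedFactorial (q ^ 2) h2
  have hE0 : qShiftedFactorialInf (q ^ 2) (q ^ 2) ≠ 0 := qShiftedFactorialInf_ne_zero _ _ h2 h2
  have hO0 : qShiftedFactorialInf q (q ^ 2) ≠ 0 := qShiftedFactorialInf_ne_zero _ _ h2 hq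
  have hsplit : qShiftedFactorialInf (q ^ 2) (q ^ 2) =
      qShiftedFactorialInf (q ^ 2) (q ^ 4) * qShiftedFactorialInf (q ^ 4) (q ^ 4) := by
    rw [qShiftedFactorialInf_eq_even_mul_odd _ h2, ← pow_mul, ← pow_add]
  obtain ⟨R, hR⟩ := exists_norm_nodeFactor_le hq
  obtain ⟨B, hB⟩ := exists_norm_le_of_tendsto (hE.inv₀ hE0)
  have hR0 : 0 ≤ R := (norm_nonneg _).trans (hR 0 0)
  have hB0 : 0 ≤ B := (norm_nonneg _).trans (hB 0)
  let r : ℕ → ℕ → ℂ := fun M k => nodeFactor q M k ^ 2 /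
    (qShiftedFactorial (q ^ 2) (q ^ 2) (2 * M - k) *
      qShiftedFactorial (q ^ 2) (q ^ 2) (2 * M + 1 + k))
  have hr (k : ℕ) : Tendsto (fun M => r M k) atTop (𝓝 (qShiftedFactorialInf q (q ^ 2) ^ 2 /
      (qShiftedFactorialInf (q ^ 2) (q ^ 2) * qShiftedFactorialInf (q ^ 2) (q ^ 2)))) := by
    refine ((tendsto_nodeFactor hq k).pow 2).div (Tendsto.mul (hE.comp ?_) (hE.comp ?_))
      (mul_ne_zero hE0 hE0)
    · have h : Tendsto (fun M : ℕ => 2 * M) atTop atTop :=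
        tendsto_atTop_mono (fun M => by dsimp only [id]; omega) tendsto_id
      exact (tendsto_sub_atTop_nat k).comp h
    · exact tendsto_atTop_mono (fun M => by dsimp only [id]; omega) tendsto_id
  have hrb (M k : ℕ) : ‖r M k‖ ≤ R ^ 2 * (B * B) := by
    simp only [r]
    rw [div_eq_mul_inv, mul_inv, norm_mul, norm_mul, norm_pow]
    gcongr
    · exact hR M k
    · exact hB _
    · exact hB _
  have hlim := tendsto_tsum_of_dominated_convergence (𝓕 := atTop)
    (f := fun M k => if k ∈ Finset.range (2 * M + 1) then t k * r M k else 0)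
    (g := fun k => t k * (qShiftedFactorialInf q (q ^ 2) ^ 2 /
      (qShiftedFactorialInf (q ^ 2) (q ^ 2) * qShiftedFactorialInf (q ^ 2) (q ^ 2))))
    (summable_bound hq (2 / (1 - ‖q‖) ^ 3 * (R ^ 2 * (B * B)))) ?_ ?_
  -- The limits of the two sides of the finite identity agree.
  · have hfin (M : ℕ) : ∑' k, (if k ∈ Finset.range (2 * M + 1) then t k * r M k else 0) =
        qShiftedFactorial (q ^ 4) (q ^ 4) M ^ 4 /
          qShiftedFactorial q (q ^ 2) (2 * M + 1) ^ 2 := by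
      rw [tsum_eq_sum (s := Finset.range (2 * M + 1)) fun k hk => if_neg hk,
        ← finite_identity hq0 hq]
      exact Finset.sum_congr rfl fun k hk => if_pos hk
    simp only [hfin] at hlim
    have hodd : Tendsto (fun M : ℕ => 2 * M + 1) atTop atTop :=
      tendsto_atTop_mono (fun M => by dsimp only [id]; omega) tendsto_id
    have hlim' := ((tendsto_qShiftedFactorial (q ^ 4) h4).pow 4).div
      (((tendsto_qShiftedFactorial q h2).comp hodd).pow 2) (pow_ne_zero 2 hO0)
    have heq := tendsto_nhds_unique hlim hlim'
    rw [tsum_mul_right] at heq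
    convert hsum.hasSum using 1
    rw [hsplit] at heq hE0
    have ha := left_ne_zero_of_mul hE0
    have hb := right_ne_zero_of_mul hE0
    field_simp at heq ⊢
    linear_combination -heq
  · intro k
    refine ((hr k).const_mul (t k)).congr' ?_
    filter_upwards [eventually_ge_atTop k] with M hM
    rw [if_pos (Finset.mem_range.mpr (by omega))]
  · refine Eventually.of_forall fun M k => ?_
    have h0 : 0 < 1 - ‖q‖ := by linarith
    split_ifs
    · rw [norm_mul, mul_right_comm]
      exact mul_le_mul (norm_term_le hq k) (hrb M k) (norm_nonneg _) (by positivity)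
    · rw [norm_zero]
      positivity

theorem theorem1 (q : ℂ) (hq : ‖q‖ < 1) :
    HasSum
      (fun k : ℕ =>
        (-1 : ℂ) ^ k * (q ^ (2 * k) * (1 + q ^ (2 * k + 1)) / (1 - q ^ (2 * k + 1)) ^ 3))
      (qShiftedFactorialInf (q ^ 2) (q ^ 4) ^ 2 * qShiftedFactorialInf (q ^ 4) (q ^ 4) ^ 6 /
        qShiftedFactorialInf q (q ^ 2) ^ 4) := by
  rcases eq_or_ne q 0 with rfl | hq0
  -- For `q = 0` only the term `k = 0` is nonzero, and both sides are `1`.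
  · convert hasSum_single (0 : ℕ) ?_ using 1
    · simp [qShiftedFactorialInf]
    · intro k hk
      simp [hk]
  · exact hasSum_of_ne_zero hq0 hq
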